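/- **Theorem 4.** For an irrational number $\alpha$, the irrationality base $\beta(\alpha)$ is the least real number $\beta>0$ (if there is one) such that for every $\varepsilon>0$ there is a positive integer $q(\varepsilon)$ with $|\alpha-p/q|>(\beta+\varepsilon)^{-q}$ for all integers $p,q$ with $q\ge q(\varepsilon)$. A real number $\theta$ is approximable to order $\omega$ if for every $C>0$ there are integers $p,q$ with $q>C$ and $|\theta-p/q|<\omega(q)$. Let $\beta>1$ be real. Construct rational numbers $r_1,r_2,\dots$ as follows, writing $b_n$ for the denominator of $r_n$ in lowest terms and $t_0=1$, $t_n=b_n^{t_{n-1}}$ for $n\ge1$. * If $\beta=b/a$ is rational in lowest terms, $0<a<b$, put $r_n=a/b$ for all $n\ge1$. * If $\beta$ is irrational, write $1-\beta^{-1}=\sum_{j\ge1}2^{-k_j}$ with $0<k_1<k_2<\cdots$, and put $S_j=\sum_{i=1}^{j}2^{-k_i}$, $n_0=0$. Choose successively $n_1<n_2<\cdots$ (with $n_1>0$), setting $r_n=1-S_j$ for $n_{j-1}<n\le n_j$, such that $2^{k_{j+1}}\le t_{n_j}$ for all $j\ge1$. Such a construction is always possible, and, for all choices made in it, the series $$\tau_\beta=\sum_{n=1}^{\infty}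 r_n^{\,t_{n-1}}$$ converges to an irrational number whose irrationality base is $\beta$. Moreover, $$\left|\tau_\beta-\frac pq\right|>\frac1{\beta^{q}}\quad\text{for all integers } p,q \text{ with } q>0 \text{ sufficiently large},$$ so that $\tau_\beta$ is not approximable to order $\beta^{-x}$. If $\beta=b/a$ is rational in lowest terms with $b>0$, then $$\tau_\beta=\beta^{-1}+\beta^{-b}+\beta^{-b^{b}}+\beta^{-b^{b^{b}}}+\cdots .$$ -/

import Mathlib

/-- `b` has the property that for every `ε > 0`, one has `|α - p/q| > 1/(b + ε)^q` for all
integers `p, q` with `q` at least some positive `q(ε)`. -/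
def BoundsIrrationality (α b : ℝ) : Prop :=
  ∀ ε : ℝ, 0 < ε → ∃ Q : ℕ, 0 < Q ∧
    ∀ (p : ℤ) (q : ℕ), Q ≤ q → 1 / (b + ε) ^ q < |α - (p : ℝ) / (q : ℝ)|

/-- The irrational number `α` has (finite) irrationality base `β`: `β` is the least positive real
number with the property above. -/
def HasIrrationalityBase (α β : ℝ) : Prop :=
  Irrational α ∧ IsLeast {b : ℝ | 0 < b ∧ BoundsIrrationality α b} β

/-- `θ` is approximable to order `ω`: there are integers `p, q` with `q` arbitrarily large and
`|θ - p/q| < ω(q)`. -/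
def ApproximableToOrder (θ : ℝ) (ω : ℝ → ℝ) : Prop :=
  ∀ C : ℝ, 0 < C → ∃ (p : ℤ) (q : ℕ), C < (q : ℝ) ∧ |θ - (p : ℝ) / (q : ℝ)| < ω q

/-- The tower `t 0 = 1`, `t n = b n ^ t (n - 1)`, attached to `b 1, b 2, …`
(the value `b 0` is not used). -/
def tower (b : ℕ → ℕ) : ℕ → ℕ
  | 0 => 1
  | n + 1 => b (n + 1) ^ tower b n

/-- The tower attached to the denominators (in lowest terms) of the rationals `r 1, r 2, …`. -/
def denTower (r : ℕ → ℚ) : ℕ → ℕ := tower (fun n => (r n).den)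

/-- The terms `r 1, r 2 ^ t 1, r 3 ^ t 2, …` of the series attached to `r 1, r 2, …`. -/
noncomputable def seriesTerm (r : ℕ → ℚ) (n : ℕ) : ℝ := (r (n + 1) : ℝ) ^ denTower r n

/-- `x = 2^(-k 0) + 2^(-k 1) + ⋯` with `0 < k 0 < k 1 < ⋯`. -/
def IsBinaryExpansion (x : ℝ) (k : ℕ → ℕ) : Prop :=
  0 < k 0 ∧ StrictMono k ∧ HasSum (fun i => 1 / (2 : ℝ) ^ k i) x

/-- The sequence `r 1, r 2, …` is one produced by the construction for `β` (`r 0` is not used).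

* If `β = b / a` is rational, in lowest terms, then `r n = a / b` for all `n ≥ 1`.
* If `β` is irrational, let `1 - 1/β = 2^(-k 0) + 2^(-k 1) + ⋯` in base 2, and denote by
  `S j` the sum of the first `j` terms, whose denominator is `B j = 2 ^ k (j - 1)`.
  Choose `0 = N 0 < N 1 < N 2 < ⋯` successively, with `r n = 1 - S (j + 1)` on the block
  `N j < n ≤ N (j + 1)`, the block being so long that the tower at its end is at least the next
  denominator `B (j + 2)`. (As `1 - S j` also has denominator `B j`, that tower is `denTower r`.) -/
inductive IsConstructedSequence (β : ℝ) (r : ℕ → ℚ) : Prop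
  | rational (a b : ℕ) (a_pos : 0 < a) (a_lt_b : a < b) (coprime : Nat.Coprime a b)
      (beta_eq : β = (b : ℝ) / (a : ℝ))
      (r_eq : ∀ n : ℕ, 1 ≤ n → r n = (a : ℚ) / (b : ℚ)) : IsConstructedSequence β r
  | irrational (beta_irrational : Irrational β) (k N : ℕ → ℕ)
      (expansion : IsBinaryExpansion (1 - 1 / β) k)
      (N_zero : N 0 = 0) (N_strictMono : StrictMono N)
      (r_eq : ∀ j n : ℕ, N j < n → n ≤ N (j + 1) →
        r n = 1 - ∑ i ∈ Finset.range (j + 1), 1 / (2 : ℚ) ^ k i)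
      (block_long : ∀ j : ℕ, 2 ^ k (j + 1) ≤ denTower r (N (j + 1))) : IsConstructedSequence β r

open Filter Topology

/-! Write `t n` for `denTower r n` and `s n` for the sum of the first `n` terms. Since each
denominator `b n` divides the next, nothing cancels and `s n` has denominator exactly `t n`
(`den_partialSum`). The tail `τ - s n` is comparable to its first term: it exceeds `β ^ (-t n)` and
is at most a constant times `r (n + 1) ^ t n`. As `r n` decreases to `1 / β`, the fractions `s n`
rule out every base below `β` (`le_of_boundsIrrationality`).

Conversely, let `t n ≤ q < t (n + 1)`. A fraction `p / q` equal to `s n` is far enough from `τ` by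
the lower bound on the tail; any other is kept away from `s n` or `s (n + 1)`, hence from `τ`, by
comparing denominators (`exists_forall_lt_abs_sub`). This gives irrationality as well.
`IsAdmissible` isolates what is needed of `r`, so rational and irrational `β` are treated together.
-/

theorem denTower_succ (r : ℕ → ℚ) (n : ℕ) :
    denTower r (n + 1) = (r (n + 1)).den ^ denTower r n := rfl

theorem denTower_strictMono {r : ℕ → ℚ} (h : ∀ n, 1 ≤ n → 2 ≤ (r n).den) :
    StrictMono (denTower r) := by
  refine strictMono_nat_of_lt_succ fun n => ?_
  rw [denTower_succ]
  exact Nat.lt_pow_self (h (n + 1) (by omega))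

theorem lt_denTower {r : ℕ → ℚ} (h : ∀ n, 1 ≤ n → 2 ≤ (r n).den) (n : ℕ) :
    n < denTower r n := by
  induction n with
  | zero => simp [denTower, tower]
  | succ n ih => exact lt_of_le_of_lt ih (denTower_strictMono h n.lt_succ_self)

/-! ### Denominators of sums and distances between fractions. -/

theorem two_le_den_of_mem_Ioo {x : ℚ} (h0 : 0 < x) (h1 : x < 1) : 2 ≤ x.den := by
  by_contra hlt
  have hd : x.den = 1 := by have := x.den_pos; omega
  have hx : x = x.num := (Rat.den_eq_one_iff x).1 hd |>.symm
  rw [hx] at h0 h1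
  have h0' : 0 < x.num := by exact_mod_cast h0
  have h1' : x.num < 1 := by exact_mod_cast h1
  omega

/-- Adding `y ^ m` to a rational whose denominator is small enough compared with that of `y ^ m`
gives a fraction whose lowest-terms denominator is that of `y ^ m`. -/
theorem den_add_pow_of_mul_dvd (x y : ℚ) (m : ℕ) (h : x.den * y.den ∣ y.den ^ m) :
    (x + y ^ m).den = y.den ^ m := by
  obtain ⟨c, hc⟩ := h
  have hD : (x.den : ℚ) ≠ 0 := by exact_mod_cast x.den_ne_zero
  have hb : (y.den : ℚ) ≠ 0 := by exact_mod_cast y.den_ne_zero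
  have hcQ : (y.den : ℚ) ^ m = x.den * y.den * c := by exact_mod_cast hc
  have hc0 : (c : ℚ) ≠ 0 := by
    intro h0
    rw [h0, mul_zero] at hcQ
    exact pow_ne_zero m hb hcQ
  have key : x + y ^ m =
      ((x.num * (c * y.den) + y.num ^ m : ℤ) : ℚ) / ((y.den ^ m : ℕ) : ℤ) := by
    have hx : x = x.num / x.den := (Rat.num_div_den x).symm
    have hy : y ^ m = (y.num : ℚ) ^ m / (y.den : ℚ) ^ m := by
      rw [← div_pow, Rat.num_div_den]
    rw [hy]
    push_cast
    rw [add_div]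
    congr 1
    conv_lhs => rw [hx]
    rw [hcQ]
    field_simp
  -- Modulo `y.den` this numerator is `y.num ^ m`, a unit.
  have hcop : IsCoprime (x.num * (c * y.den) + y.num ^ m) ((y.den ^ m : ℕ) : ℤ) := by
    push_cast
    refine IsCoprime.pow_right ?_
    have h1 : IsCoprime (y.num ^ m) (y.den : ℤ) :=
      (Rat.isCoprime_num_den y).pow_left
    have e : x.num * (c * y.den) + y.num ^ m = y.num ^ m + x.num * c * y.den := by ring
    rw [e]
    exact h1.add_mul_right_left (x.num * c)
  have := Rat.den_div_eq_of_coprime (a := x.num * (c * y.den) + y.num ^ m)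
    (b := ((y.den ^ m : ℕ) : ℤ)) (by exact_mod_cast pow_pos y.den_pos m)
    (Int.isCoprime_iff_gcd_eq_one.1 hcop)
  rw [← key] at this
  exact_mod_cast this

theorem one_div_le_abs_sub_of_ne (s : ℚ) (p : ℤ) {q : ℕ} (hq : 0 < q)
    (h : (p : ℚ) / q ≠ s) : 1 / ((q : ℝ) * s.den) ≤ |(s : ℝ) - p / q| := by
  have hqR : (0 : ℝ) < q := by exact_mod_cast hq
  have hdR : (0 : ℝ) < s.den := by exact_mod_cast s.den_pos
  have hs : (s : ℝ) = s.num / s.den := by exact_mod_cast (Rat.num_div_den s).symm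
  have hne : s.num * q - p * s.den ≠ 0 := by
    intro h0
    apply h
    rw [← Rat.num_div_den s]
    have hqQ : (q : ℚ) ≠ 0 := by exact_mod_cast hq.ne'
    have hdQ : (s.den : ℚ) ≠ 0 := by exact_mod_cast s.den_ne_zero
    rw [div_eq_div_iff hqQ hdQ]
    have : s.num * q = p * s.den := by linarith
    exact_mod_cast this.symm
  have h1 : (1 : ℝ) ≤ |(s.num * q - p * s.den : ℝ)| := by
    exact_mod_cast Int.one_le_abs hne
  have h2 : (s : ℝ) - p / q = (s.num * q - p * s.den) / (q * s.den) := by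
    rw [hs]; field_simp
  rw [h2, abs_div, abs_of_pos (mul_pos hqR hdR)]
  gcongr

/-- If `τ` is within `1 / (2 q d)` of a fraction with denominator `d`, then it is at least that far
from every other fraction with denominator `q`. -/
theorem one_div_two_mul_le_abs_sub {τ : ℝ} (s : ℚ) (p : ℤ) {q : ℕ} (hq : 0 < q)
    (h : (p : ℚ) / q ≠ s) (hτ : |τ - s| ≤ 1 / (2 * ((q : ℝ) * s.den))) :
    1 / (2 * ((q : ℝ) * s.den)) ≤ |τ - p / q| := by
  have h1 := one_div_le_abs_sub_of_ne s p hq h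
  have h2 : |(s : ℝ) - p / q| ≤ |τ - s| + |τ - p / q| := by
    rw [abs_sub_comm τ s]
    exact abs_sub_le _ _ _
  have h3 : 1 / (2 * ((q : ℝ) * s.den)) = 1 / ((q : ℝ) * s.den) / 2 := by
    rw [mul_comm 2, ← div_div]
  linarith

/-! ### Diophantine properties of the series of an admissible sequence. -/

/-- The properties of a constructed sequence that determine the arithmetic of its series. -/
structure IsAdmissible (β : ℝ) (r : ℕ → ℚ) : Prop where
  anti : ∀ m n, 1 ≤ m → m ≤ n → r n ≤ r m
  one_div_le : ∀ n, 1 ≤ n → 1 / β ≤ r n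
  lt_one : r 1 < 1
  tendsto : Tendsto (fun n => (r n : ℝ)) atTop (𝓝 (1 / β))
  den_dvd : ∀ n, 1 ≤ n → (r n).den ∣ (r (n + 1)).den
  den_le : ∀ᶠ n in atTop, (r (n + 1)).den ≤ denTower r n

namespace IsAdmissible

variable {β : ℝ} {r : ℕ → ℚ}

theorem pos (h : IsAdmissible β r) (hβ : 1 < β) {n : ℕ} (hn : 1 ≤ n) : 0 < r n := by
  have : (0 : ℝ) < r n := lt_of_lt_of_le (by positivity) (h.one_div_le n hn)
  exact_mod_cast this

theorem two_le_den (h : IsAdmissible β r) (hβ : 1 < β) (n : ℕ) (hn : 1 ≤ n) :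
    2 ≤ (r n).den :=
  two_le_den_of_mem_Ioo (h.pos hβ hn) (lt_of_le_of_lt (h.anti 1 n le_rfl hn) h.lt_one)

theorem strictMono (h : IsAdmissible β r) (hβ : 1 < β) : StrictMono (denTower r) :=
  denTower_strictMono (h.two_le_den hβ)

/-- Supplies the hypothesis of `den_add_pow_of_mul_dvd`: `t n` divides a power of `b (n + 1)`, and
strict growth of the tower leaves room for one more factor. -/
theorem denTower_mul_den_dvd (h : IsAdmissible β r) (hβ : 1 < β) (n : ℕ) :
    denTower r n * (r (n + 1)).den ∣ denTower r (n + 1) := by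
  cases n with
  | zero => simp [denTower, tower]
  | succ n =>
    rw [denTower_succ r (n + 1), denTower_succ r n]
    have h1 := pow_dvd_pow_of_dvd (h.den_dvd (n + 1) (by omega)) (denTower r n)
    have h2 : denTower r n + 1 ≤ (r (n + 1)).den ^ denTower r n :=
      h.strictMono hβ n.lt_succ_self
    calc (r (n + 1)).den ^ denTower r n * (r (n + 1 + 1)).den
        ∣ (r (n + 1 + 1)).den ^ denTower r n * (r (n + 1 + 1)).den := mul_dvd_mul_right h1 _
      _ = (r (n + 1 + 1)).den ^ (denTower r n + 1) := (pow_succ _ _).symm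
      _ ∣ _ := pow_dvd_pow _ h2

theorem den_partialSum (h : IsAdmissible β r) (hβ : 1 < β) (n : ℕ) :
    (∑ i ∈ Finset.range n, r (i + 1) ^ denTower r i).den = denTower r n := by
  induction n with
  | zero => simp [denTower, tower]
  | succ n ih =>
    rw [Finset.sum_range_succ, denTower_succ]
    refine den_add_pow_of_mul_dvd _ _ _ ?_
    rw [ih, ← denTower_succ]
    exact h.denTower_mul_den_dvd hβ n

theorem seriesTerm_pos (h : IsAdmissible β r) (hβ : 1 < β) (n : ℕ) : 0 < seriesTerm r n := by
  have : (0 : ℝ) < r (n + 1) := by exact_mod_cast h.pos hβ (by omega)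
  exact pow_pos this _

/-- Bases decrease and exponents grow by at least one per step, so tails are dominated by a
geometric series. -/
theorem seriesTerm_add_le (h : IsAdmissible β r) (hβ : 1 < β) (n i : ℕ) :
    seriesTerm r (i + n) ≤ seriesTerm r n * (r 1 : ℝ) ^ i := by
  have p1 : (0 : ℝ) ≤ r (n + 1) := by exact_mod_cast (h.pos hβ (by omega)).le
  have p2 : (0 : ℝ) ≤ r (i + n + 1) := by exact_mod_cast (h.pos hβ (by omega)).le
  have a1 : (r (i + n + 1) : ℝ) ≤ r (n + 1) := by
    exact_mod_cast h.anti (n + 1) (i + n + 1) (by omega) (by omega)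
  have a2 : (r (n + 1) : ℝ) ≤ r 1 := by exact_mod_cast h.anti 1 (n + 1) le_rfl (by omega)
  have a3 : (r 1 : ℝ) ≤ 1 := by exact_mod_cast h.lt_one.le
  have hT : denTower r n + i ≤ denTower r (i + n) := by
    rw [add_comm (denTower r n) i]; exact (h.strictMono hβ).add_le_nat i n
  unfold seriesTerm
  calc (r (i + n + 1) : ℝ) ^ denTower r (i + n)
      ≤ (r (n + 1) : ℝ) ^ denTower r (i + n) := by gcongr
    _ ≤ (r (n + 1) : ℝ) ^ (denTower r n + i) := pow_le_pow_of_le_one p1 (a2.trans a3) hT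
    _ = (r (n + 1) : ℝ) ^ denTower r n * (r (n + 1) : ℝ) ^ i := pow_add _ _ _
    _ ≤ _ := by gcongr

theorem r_one_nonneg (h : IsAdmissible β r) (hβ : 1 < β) : (0 : ℝ) ≤ r 1 := by
  exact_mod_cast (h.pos hβ le_rfl).le

theorem r_one_lt (h : IsAdmissible β r) : (r 1 : ℝ) < 1 := by exact_mod_cast h.lt_one

theorem summable (h : IsAdmissible β r) (hβ : 1 < β) : Summable (seriesTerm r) := by
  refine Summable.of_nonneg_of_le (fun n => (h.seriesTerm_pos hβ n).le)
    (fun n => by simpa using h.seriesTerm_add_le hβ 0 n)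
    ((summable_geometric_of_lt_one (h.r_one_nonneg hβ) h.r_one_lt).mul_left _)

theorem sub_partialSum_eq (h : IsAdmissible β r) (hβ : 1 < β) {τ : ℝ}
    (hτ : HasSum (seriesTerm r) τ) (n : ℕ) :
    τ - ((∑ i ∈ Finset.range n, r (i + 1) ^ denTower r i : ℚ) : ℝ) =
      ∑' i, seriesTerm r (i + n) := by
  have := (h.summable hβ).sum_add_tsum_nat_add n
  rw [hτ.tsum_eq] at this
  push_cast
  unfold seriesTerm at this ⊢
  linarith

theorem lt_sub_partialSum (h : IsAdmissible β r) (hβ : 1 < β) {τ : ℝ}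
    (hτ : HasSum (seriesTerm r) τ) (n : ℕ) :
    1 / β ^ denTower r n <
      τ - ((∑ i ∈ Finset.range n, r (i + 1) ^ denTower r i : ℚ) : ℝ) := by
  rw [h.sub_partialSum_eq hβ hτ]
  have hs : Summable fun i => seriesTerm r (i + n) := (summable_nat_add_iff n).2 (h.summable hβ)
  have h1 : 1 / β ^ denTower r n ≤ seriesTerm r n := by
    rw [← one_div_pow]
    exact pow_le_pow_left₀ (by positivity) (h.one_div_le (n + 1) (by omega)) _
  -- The first tail term gives the bound; the second makes it strict.
  have h2 := hs.sum_le_tsum (Finset.range 2) (fun i _ => (h.seriesTerm_pos hβ (i + n)).le)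
  have h3 := h.seriesTerm_pos hβ (1 + n)
  simp only [Finset.sum_range_succ, Finset.sum_range_zero, zero_add] at h2
  linarith

theorem sub_partialSum_le (h : IsAdmissible β r) (hβ : 1 < β) {τ : ℝ}
    (hτ : HasSum (seriesTerm r) τ) (n : ℕ) :
    τ - ((∑ i ∈ Finset.range n, r (i + 1) ^ denTower r i : ℚ) : ℝ) ≤
      (1 - (r 1 : ℝ))⁻¹ * seriesTerm r n := by
  rw [h.sub_partialSum_eq hβ hτ]
  have hs : Summable fun i => seriesTerm r (i + n) := (summable_nat_add_iff n).2 (h.summable hβ)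
  have hg := summable_geometric_of_lt_one (h.r_one_nonneg hβ) h.r_one_lt
  have := hs.tsum_le_tsum (fun i => h.seriesTerm_add_le hβ n i) (hg.mul_left _)
  rwa [tsum_mul_left, tsum_geometric_of_lt_one (h.r_one_nonneg hβ) h.r_one_lt, mul_comm] at this

theorem seriesTerm_le (h : IsAdmissible β r) (hβ : 1 < β) (n : ℕ) :
    seriesTerm r n ≤ (r 1 : ℝ) ^ denTower r n := by
  have p1 : (0 : ℝ) ≤ r (n + 1) := by exact_mod_cast (h.pos hβ (by omega)).le
  have a2 : (r (n + 1) : ℝ) ≤ r 1 := by exact_mod_cast h.anti 1 (n + 1) le_rfl (by omega)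
  unfold seriesTerm
  gcongr

/-- With `t n ≤ q < t (n + 1)`, compare with `s n` when `q ≤ t n ^ 3` and with `s (n + 1)`
otherwise. In the second case `t (n + 1) ≤ t n ^ t n` is at most `√β ^ q`, so `2 * q * t (n + 1) < β
^ q`. -/
theorem exists_forall_lt_abs_sub (h : IsAdmissible β r) (hβ : 1 < β) {τ : ℝ}
    (hτ : HasSum (seriesTerm r) τ) :
    ∃ Q : ℕ, 0 < Q ∧
      ∀ (p : ℤ) (q : ℕ), Q ≤ q → 1 / β ^ q < |τ - (p : ℝ) / (q : ℝ)| := by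
  set s : ℕ → ℚ := fun n => ∑ i ∈ Finset.range n, r (i + 1) ^ denTower r i with hs
  set C : ℝ := (1 - (r 1 : ℝ))⁻¹ with hC
  have hC0 : 0 ≤ C := inv_nonneg.2 (by linarith [h.r_one_lt])
  have hρ := h.r_one_nonneg hβ
  have hT := (h.strictMono hβ).tendsto_atTop
  obtain ⟨γ, hγ1, hγβ⟩ : ∃ γ : ℝ, 1 < γ ∧ γ * γ = β :=
    ⟨√β, Real.lt_sqrt_of_sq_lt (by simpa using hβ), Real.mul_self_sqrt (by linarith)⟩
  -- The fourth power is `q * t m` with `q ≤ t m ^ 3`.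
  have E1 : ∀ᶠ M : ℕ in atTop, 2 * C * ((M : ℝ) ^ 4 * (r 1 : ℝ) ^ M) ≤ 1 := by
    have := (tendsto_pow_const_mul_const_pow_of_abs_lt_one 4
      (r := (r 1 : ℝ)) (by rw [abs_of_nonneg hρ]; exact h.r_one_lt)).const_mul (2 * C)
    rw [mul_zero] at this
    exact this.eventually_le_const one_pos
  have Eg : ∀ (k : ℕ) (g c : ℝ), 1 < g → 0 < c →
      ∀ᶠ q : ℕ in atTop, (q : ℝ) ^ k < c * g ^ q := by
    intro k g c hg hc
    filter_upwards [(tendsto_pow_const_div_const_pow_of_one_lt k hg).eventually_lt_const hc]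
      with q hq
    rwa [div_lt_iff₀ (pow_pos (by linarith) q)] at hq
  obtain ⟨n₀, hn₀⟩ := eventually_atTop.1
    ((hT.eventually (E1.and (Eg 1 γ 1 hγ1 one_pos))).and h.den_le)
  obtain ⟨q₀, hq₀⟩ := eventually_atTop.1
    ((Eg 2 β (1 / 2) hβ (by norm_num)).and (Eg 1 γ (1 / 2) hγ1 (by norm_num)))
  refine ⟨max q₀ (denTower r n₀) + 1, by omega, fun p q hq => ?_⟩
  have hq0 : q₀ ≤ q := by omega
  have hqT : denTower r n₀ ≤ q := by omega
  have hqpos : 0 < q := by omega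
  have hqR : (0 : ℝ) < q := by exact_mod_cast hqpos
  have hex : ∃ m, q < denTower r m := ⟨q, lt_denTower (h.two_le_den hβ) q⟩
  obtain ⟨n, hn1, hn2⟩ : ∃ n, denTower r n ≤ q ∧ q < denTower r (n + 1) := by
    classical
    obtain ⟨n, hn⟩ : ∃ n, Nat.find hex = n + 1 := by
      refine Nat.exists_eq_succ_of_ne_zero fun h0 => ?_
      have := Nat.find_spec hex
      rw [h0] at this
      simp [denTower, tower] at this
      omega
    refine ⟨n, not_lt.1 (Nat.find_min hex (by omega)), ?_⟩
    rw [← hn]; exact Nat.find_spec hex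
  have hnn : n₀ ≤ n := by
    have := (h.strictMono hβ).lt_iff_lt.1 (lt_of_le_of_lt hqT hn2)
    omega
  obtain ⟨⟨e1, e2⟩, e3⟩ := hn₀ n hnn
  obtain ⟨⟨e1', -⟩, -⟩ := hn₀ (n + 1) (by omega)
  obtain ⟨f1, f2⟩ := hq₀ q hq0
  have hβ0 : 0 < β := by linarith
  have hden : ∀ m, (s m).den = denTower r m := h.den_partialSum hβ
  have habs : ∀ m, |τ - s m| ≤ C * (r 1 : ℝ) ^ denTower r m := by
    intro m
    rw [abs_of_pos (lt_trans (by positivity) (h.lt_sub_partialSum hβ hτ m))]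
    exact (h.sub_partialSum_le hβ hτ m).trans
      (mul_le_mul_of_nonneg_left (h.seriesTerm_le hβ m) hC0)
  have hTpos : ∀ m, (0 : ℝ) < denTower r m := fun m => by
    exact_mod_cast (Nat.zero_le m).trans_lt (lt_denTower (h.two_le_den hβ) m)
  have hT1 : ∀ m, (1 : ℝ) ≤ denTower r m := fun m => by
    exact_mod_cast (Nat.zero_le m).trans_lt (lt_denTower (h.two_le_den hβ) m)
  -- the distance bound obtained from one partial sum
  have main : ∀ m, (p : ℚ) / q ≠ s m → (q : ℝ) ≤ (denTower r m : ℝ) ^ 3 →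
      2 * C * ((denTower r m : ℝ) ^ 4 * (r 1 : ℝ) ^ denTower r m) ≤ 1 →
      2 * ((q : ℝ) * denTower r m) < β ^ q → 1 / β ^ q < |τ - (p : ℝ) / (q : ℝ)| := by
    intro m hne hqm he hlt
    have hpos := hTpos m
    refine lt_of_lt_of_le ?_ (one_div_two_mul_le_abs_sub (s m) p hqpos hne ?_)
    · rw [hden]
      exact one_div_lt_one_div_of_lt (by positivity) hlt
    · rw [hden]
      refine (habs m).trans ?_
      rw [le_div_iff₀ (by positivity)]
      calc C * (r 1 : ℝ) ^ denTower r m * (2 * (q * denTower r m))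
          ≤ C * (r 1 : ℝ) ^ denTower r m * (2 * ((denTower r m : ℝ) ^ 3 * denTower r m)) := by
            gcongr
        _ = 2 * C * ((denTower r m : ℝ) ^ 4 * (r 1 : ℝ) ^ denTower r m) := by ring
        _ ≤ 1 := he
  have hn1R : (denTower r n : ℝ) ≤ q := by exact_mod_cast hn1
  have hn2R : (q : ℝ) ≤ denTower r (n + 1) := by exact_mod_cast hn2.le
  by_cases hsmall : (q : ℝ) ≤ (denTower r n : ℝ) ^ 3
  · by_cases hp : (p : ℚ) / q = s n
    · have hp' : (p : ℝ) / q = s n := by exact_mod_cast congrArg (Rat.cast : ℚ → ℝ) hp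
      rw [hp']
      refine lt_of_le_of_lt ?_ ((h.lt_sub_partialSum hβ hτ n).trans_le (le_abs_self _))
      exact one_div_le_one_div_of_le (by positivity) (pow_le_pow_right₀ hβ.le hn1)
    · refine main n hp hsmall e1 ?_
      have : (q : ℝ) * denTower r n ≤ q ^ 2 := by rw [sq]; gcongr
      linarith
  · push Not at hsmall
    refine main (n + 1) ?_ ?_ e1' ?_
    -- Equality would force the denominator `t (n + 1)` to be at most `q`.
    · intro hp
      have h1 : ((p : ℚ) / (q : ℤ)).den ≤ q := by
        have := Rat.den_dvd p q
        rw [Rat.divInt_eq_div] at this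
        exact Nat.le_of_dvd hqpos (by exact_mod_cast this)
      have h2 : ((p : ℚ) / (q : ℤ)) = s (n + 1) := by exact_mod_cast hp
      rw [h2, hden] at h1
      omega
    · exact hn2R.trans (le_self_pow₀ (hT1 _) (by norm_num))
    · have hM3 : denTower r n ^ 3 ≤ q := by exact_mod_cast hsmall.le
      have hb : ((r (n + 1)).den : ℝ) ≤ denTower r n := by exact_mod_cast e3
      have g1 : (denTower r (n + 1) : ℝ) ≤ γ ^ q := by
        rw [denTower_succ]
        push_cast
        have hMγ : (denTower r n : ℝ) ≤ γ ^ denTower r n ^ 2 := by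
          rw [pow_one, one_mul] at e2
          exact e2.le.trans (pow_le_pow_right₀ hγ1.le (Nat.le_self_pow (by norm_num) _))
        calc ((r (n + 1)).den : ℝ) ^ denTower r n
            ≤ (γ ^ denTower r n ^ 2) ^ denTower r n := by
              gcongr; exact hb.trans hMγ
          _ = γ ^ denTower r n ^ 3 := by rw [← pow_mul, ← pow_succ]
          _ ≤ γ ^ q := pow_le_pow_right₀ hγ1.le hM3
      rw [← hγβ, mul_pow]
      have g0 : 0 < γ ^ q := by positivity
      rw [pow_one] at f2
      calc 2 * ((q : ℝ) * denTower r (n + 1)) ≤ 2 * (q * γ ^ q) := by gcongr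
        _ < γ ^ q * γ ^ q := by nlinarith

theorem irrational (h : IsAdmissible β r) (hβ : 1 < β) {τ : ℝ}
    (hτ : HasSum (seriesTerm r) τ) : Irrational τ := by
  rintro ⟨x, rfl⟩
  obtain ⟨Q, hQ, hlt⟩ := h.exists_forall_lt_abs_sub hβ hτ
  -- Scaling by `Q` writes `x` with a denominator large enough for the bound.
  have h1 := hlt (Q * x.num) (Q * x.den) (Nat.le_mul_of_pos_right _ x.den_pos)
  have hx : (x : ℝ) = ((Q * x.num : ℤ) : ℝ) / ((Q * x.den : ℕ) : ℝ) := by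
    have hQ' : (Q : ℝ) ≠ 0 := by exact_mod_cast hQ.ne'
    push_cast
    rw [mul_div_mul_left _ _ hQ']
    exact_mod_cast (Rat.num_div_den x).symm
  rw [← hx, sub_self, abs_zero] at h1
  have : 0 < β := by linarith
  exact absurd h1 (not_lt.2 (by positivity))

theorem le_of_boundsIrrationality (h : IsAdmissible β r) (hβ : 1 < β) {τ : ℝ}
    (hτ : HasSum (seriesTerm r) τ) {b : ℝ} (hb : 0 < b) (hB : BoundsIrrationality τ b) :
    β ≤ b := by
  by_contra! hlt
  obtain ⟨Q, -, hQ⟩ := hB ((β - b) / 2) (by linarith)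
  -- The midpoint `b' < β` makes `r (n + 1) * b'` eventually less than some `c < 1`, so `(τ - s n) *
  -- b' ^ t n` tends to `0`.
  set b' := b + (β - b) / 2 with hb'
  have hb'0 : 0 < b' := by linarith
  have hb'β : b' / β < 1 := by rw [div_lt_one (by linarith)]; linarith
  obtain ⟨c, hc1, hc2⟩ := exists_between hb'β
  have hc0 : 0 < c := lt_trans (div_pos hb'0 (by linarith)) hc1
  have hT := (h.strictMono hβ).tendsto_atTop
  have hr : ∀ᶠ n in atTop, (r (n + 1) : ℝ) * b' < c := by
    have := ((h.tendsto.comp (tendsto_add_atTop_nat 1)).mul_const b')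
    refine this.eventually_lt_const ?_
    rwa [one_div, inv_mul_eq_div]
  have hsm : ∀ᶠ n in atTop, (1 - (r 1 : ℝ))⁻¹ * c ^ denTower r n < 1 := by
    have := ((tendsto_pow_atTop_nhds_zero_of_lt_one hc0.le hc2).comp hT).const_mul
      (1 - (r 1 : ℝ))⁻¹
    rw [mul_zero] at this
    exact this.eventually_lt_const one_pos
  obtain ⟨n, h1, h2, h3⟩ := (hr.and (hsm.and (hT.eventually (eventually_ge_atTop Q)))).exists
  set s : ℚ := ∑ i ∈ Finset.range n, r (i + 1) ^ denTower r i with hs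
  have hden : s.den = denTower r n := h.den_partialSum hβ n
  have h4 := hQ s.num s.den (by rw [hden]; exact h3)
  have hsx : (s.num : ℝ) / s.den = s := by exact_mod_cast Rat.num_div_den s
  have hβ0 : 0 < β := by linarith
  rw [hsx, hden, abs_of_pos (lt_trans (by positivity) (h.lt_sub_partialSum hβ hτ n)),
    div_lt_iff₀ (by positivity)] at h4
  have hC0 : 0 ≤ (1 - (r 1 : ℝ))⁻¹ := inv_nonneg.2 (by linarith [h.r_one_lt])
  have p1 : (0 : ℝ) ≤ r (n + 1) := by exact_mod_cast (h.pos hβ (by omega)).le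
  have h5 : (1 : ℝ) < 1 := calc
    1 < (τ - s) * b' ^ denTower r n := h4
    _ ≤ (1 - (r 1 : ℝ))⁻¹ * seriesTerm r n * b' ^ denTower r n := by
      gcongr; exact h.sub_partialSum_le hβ hτ n
    _ = (1 - (r 1 : ℝ))⁻¹ * (r (n + 1) * b') ^ denTower r n := by
      rw [seriesTerm, mul_pow]; ring
    _ ≤ (1 - (r 1 : ℝ))⁻¹ * c ^ denTower r n := by gcongr
    _ < 1 := h2
  exact lt_irrefl _ h5

theorem hasIrrationalityBase (h : IsAdmissible β r) (hβ : 1 < β) {τ : ℝ}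
    (hτ : HasSum (seriesTerm r) τ) : HasIrrationalityBase τ β := by
  refine ⟨h.irrational hβ hτ, ⟨by linarith, fun ε hε => ?_⟩, fun b hb =>
    h.le_of_boundsIrrationality hβ hτ hb.1 hb.2⟩
  obtain ⟨Q, hQ, hlt⟩ := h.exists_forall_lt_abs_sub hβ hτ
  refine ⟨Q, hQ, fun p q hq => lt_of_le_of_lt ?_ (hlt p q hq)⟩
  have hβ0 : 0 < β := by linarith
  exact one_div_le_one_div_of_le (by positivity) (by gcongr; linarith)

theorem not_approximableToOrder (h : IsAdmissible β r) (hβ : 1 < β) {τ : ℝ}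
    (hτ : HasSum (seriesTerm r) τ) : ¬ ApproximableToOrder τ (fun x => β ^ (-x)) := by
  intro hA
  obtain ⟨Q, hQ, hlt⟩ := h.exists_forall_lt_abs_sub hβ hτ
  obtain ⟨p, q, hq, hpq⟩ := hA Q (by exact_mod_cast hQ)
  have h1 := hlt p q (by exact_mod_cast hq.le)
  have hβ0 : 0 < β := by linarith
  simp only [Real.rpow_neg hβ0.le, Real.rpow_natCast, ← one_div] at hpq
  exact absurd hpq (not_lt.2 h1.le)

end IsAdmissible

/-! ### Admissibility for rational `β`. -/

theorem den_natCast_div_of_coprime {a b : ℕ} (hb : 0 < b) (h : Nat.Coprime a b) :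
    ((a : ℚ) / b).den = b := by
  have := Rat.den_div_eq_of_coprime (a := a) (b := b) (by exact_mod_cast hb) (by simpa using h)
  rw [Int.cast_natCast, Int.cast_natCast] at this
  exact Int.natCast_inj.1 this

theorem IsAdmissible.of_const {β : ℝ} {r : ℕ → ℚ} {a b : ℕ} (ha : 0 < a) (hab : a < b)
    (hcop : Nat.Coprime a b) (hβ : β = (b : ℝ) / a)
    (hr : ∀ n : ℕ, 1 ≤ n → r n = (a : ℚ) / b) : IsAdmissible β r := by
  have hb : 0 < b := ha.trans hab
  have hrR : ∀ n, 1 ≤ n → (r n : ℝ) = 1 / β := fun n hn => by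
    rw [hr n hn, hβ, one_div_div]; push_cast; rfl
  have hden : ∀ n, 1 ≤ n → (r n).den = b := fun n hn => by
    rw [hr n hn, den_natCast_div_of_coprime hb hcop]
  have hlt : r 1 < 1 := by
    rw [hr 1 le_rfl, div_lt_one (by exact_mod_cast hb)]
    exact_mod_cast hab
  have h2 : ∀ n, 1 ≤ n → 2 ≤ (r n).den := fun n hn => by rw [hden n hn]; omega
  refine ⟨fun m n hm hmn => by rw [hr m hm, hr n (hm.trans hmn)], fun n hn => (hrR n hn).ge, hlt,
    ?_, fun n hn => by rw [hden n hn, hden (n + 1) (by omega)], ?_⟩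
  · refine tendsto_const_nhds.congr' ?_
    filter_upwards [eventually_ge_atTop 1] with n hn using (hrR n hn).symm
  · filter_upwards [eventually_ge_atTop b] with n hn
    rw [hden (n + 1) (by omega)]
    exact hn.trans (lt_denTower h2 n).le

/-! ### Binary blocks for irrational `β`. -/

theorem den_sum_one_div_two_pow {k : ℕ → ℕ} (h0 : 0 < k 0) (hk : StrictMono k) (j : ℕ) :
    (∑ i ∈ Finset.range (j + 1), 1 / (2 : ℚ) ^ k i).den = 2 ^ k j := by
  have h2 : (1 / 2 : ℚ).den = 2 := by norm_num
  have key : ∀ (x : ℚ) (m : ℕ), x.den * 2 ∣ 2 ^ m → (x + 1 / 2 ^ m).den = 2 ^ m := by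
    intro x m hx
    have := den_add_pow_of_mul_dvd x (1 / 2) m (by rwa [h2])
    rwa [h2, one_div_pow] at this
  induction j with
  | zero =>
    rw [Finset.sum_range_succ, Finset.sum_range_zero]
    exact key 0 _ (by rw [Rat.den_zero, one_mul]; exact dvd_pow_self 2 h0.ne')
  | succ j ih =>
    rw [Finset.sum_range_succ]
    refine key _ _ ?_
    rw [ih, ← pow_succ]
    exact pow_dvd_pow _ (hk j.lt_succ_self)

theorem den_one_sub (x : ℚ) : (1 - x).den = x.den := by
  exact_mod_cast Rat.intCast_sub_den 1 x

theorem exists_block {N : ℕ → ℕ} (h0 : N 0 = 0) (hN : StrictMono N) {n : ℕ} (hn : 1 ≤ n) :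
    ∃ j, N j < n ∧ n ≤ N (j + 1) := by
  classical
  have hex : ∃ m, n ≤ N m := ⟨n, hN.le_apply⟩
  obtain ⟨j, hj⟩ : ∃ j, Nat.find hex = j + 1 := by
    refine Nat.exists_eq_succ_of_ne_zero fun h => ?_
    have := Nat.find_spec hex
    rw [h] at this
    omega
  refine ⟨j, not_le.1 (Nat.find_min hex (by omega)), ?_⟩
  rw [← hj]; exact Nat.find_spec hex

theorem block_le_block {N : ℕ → ℕ} (hN : StrictMono N) {m n i j : ℕ} (hmn : m ≤ n)
    (hi : N i < m) (hj : n ≤ N (j + 1)) : i ≤ j :=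
  Nat.lt_succ_iff.1 (hN.lt_iff_lt.1 (hi.trans_le (hmn.trans hj)))

section Blocks

variable {β : ℝ} {r : ℕ → ℚ} {k N : ℕ → ℕ}

theorem IsAdmissible.of_blocks (hk : IsBinaryExpansion (1 - 1 / β) k)
    (hN0 : N 0 = 0) (hN : StrictMono N)
    (hr : ∀ j n : ℕ, N j < n → n ≤ N (j + 1) →
      r n = 1 - ∑ i ∈ Finset.range (j + 1), 1 / (2 : ℚ) ^ k i)
    (hlong : ∀ j : ℕ, 2 ^ k (j + 1) ≤ denTower r (N (j + 1))) : IsAdmissible β r := by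
  obtain ⟨hk0, hk, hsum⟩ := hk
  have hden : ∀ j n, N j < n → n ≤ N (j + 1) → (r n).den = 2 ^ k j := fun j n h1 h2 => by
    rw [hr j n h1 h2, den_one_sub, den_sum_one_div_two_pow hk0 hk]
  choose! J hJ1 hJ2 using fun (n : ℕ) (hn : 1 ≤ n) => exists_block hN0 hN hn
  have hrR : ∀ n, 1 ≤ n →
      (r n : ℝ) = 1 - ∑ i ∈ Finset.range (J n + 1), 1 / (2 : ℝ) ^ k i := fun n hn => by
    rw [hr _ n (hJ1 n hn) (hJ2 n hn)]; push_cast; rfl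
  have hden2 : ∀ n, 1 ≤ n → 2 ≤ (r n).den := fun n hn => by
    rw [hden _ n (hJ1 n hn) (hJ2 n hn)]
    have : 0 < k (J n) := hk0.trans_le (hk.monotone (Nat.zero_le _))
    exact Nat.le_self_pow this.ne' 2
  refine ⟨fun m n hm hmn => ?_, fun n hn => ?_, ?_, ?_, fun n hn => ?_, ?_⟩
  · have hn := hm.trans hmn
    rw [hr _ n (hJ1 n hn) (hJ2 n hn), hr _ m (hJ1 m hm) (hJ2 m hm)]
    refine sub_le_sub_left (Finset.sum_le_sum_of_subset_of_nonneg ?_ fun i _ _ => by positivity) _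
    have := block_le_block hN hmn (hJ1 m hm) (hJ2 n hn)
    exact Finset.range_mono (by omega)
  · rw [hrR n hn]
    have := sum_le_hasSum (Finset.range (J n + 1)) (fun i _ => by positivity) hsum
    linarith
  · rw [hr _ 1 (hJ1 1 le_rfl) (hJ2 1 le_rfl)]
    have : 0 < ∑ i ∈ Finset.range (J 1 + 1), 1 / (2 : ℚ) ^ k i :=
      Finset.sum_pos (fun i _ => by positivity) (by simp)
    linarith
  · have hJ : Tendsto (fun n => J n + 1) atTop atTop := by
      refine tendsto_atTop.2 fun j => ?_
      filter_upwards [eventually_gt_atTop (N j)] with n hn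
      have := block_le_block hN le_rfl hn (hJ2 n (by omega))
      omega
    have h1 := (hsum.tendsto_sum_nat.comp hJ).const_sub 1
    rw [sub_sub_cancel] at h1
    refine h1.congr' ?_
    filter_upwards [eventually_ge_atTop 1] with n hn using (hrR n hn).symm
  · rw [hden _ n (hJ1 n hn) (hJ2 n hn), hden _ (n + 1) (hJ1 _ (by omega)) (hJ2 _ (by omega))]
    exact pow_dvd_pow _ (hk.monotone
      (block_le_block hN n.le_succ (hJ1 n hn) (hJ2 _ (by omega))))
  · filter_upwards [eventually_ge_atTop (N 1)] with n hn
    have h1 := hJ1 (n + 1) (by omega)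
    have h2 := hJ2 (n + 1) (by omega)
    rw [hden _ _ h1 h2]
    -- Index `n + 1` lies past the first block, so the length condition on the preceding block
    -- applies.
    obtain ⟨i, hi⟩ : ∃ i, J (n + 1) = i + 1 :=
      Nat.exists_eq_succ_of_ne_zero fun h => by rw [h] at h2; simp only [zero_add] at h2; omega
    rw [hi] at h1 ⊢
    exact (hlong i).trans ((denTower_strictMono hden2).monotone (by omega))

theorem exists_blocks (h0 : 0 < k 0) (hk : StrictMono k) :
    ∃ (r : ℕ → ℚ) (N : ℕ → ℕ), N 0 = 0 ∧ StrictMono N ∧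
      (∀ j n : ℕ, N j < n → n ≤ N (j + 1) →
        r n = 1 - ∑ i ∈ Finset.range (j + 1), 1 / (2 : ℚ) ^ k i) ∧
      ∀ j : ℕ, 2 ^ k (j + 1) ≤ denTower r (N (j + 1)) := by
  -- Since `t n > n`, ending block `j` at `2 ^ k j` is already long enough.
  let N : ℕ → ℕ := fun j => if j = 0 then 0 else 2 ^ k j
  have hN0 : N 0 = 0 := rfl
  have hNs : ∀ j, N (j + 1) = 2 ^ k (j + 1) := fun j => rfl
  have hN : StrictMono N := by
    refine strictMono_nat_of_lt_succ fun j => ?_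
    cases j with
    | zero => rw [hN0, hNs]; positivity
    | succ j => rw [hNs, hNs]; exact Nat.pow_lt_pow_right one_lt_two (hk (Nat.lt_succ_self _))
  choose! J hJ1 hJ2 using fun (n : ℕ) (hn : 1 ≤ n) => exists_block hN0 hN hn
  let r : ℕ → ℚ := fun n => 1 - ∑ i ∈ Finset.range (J n + 1), 1 / (2 : ℚ) ^ k i
  have hden2 : ∀ n, 1 ≤ n → 2 ≤ (r n).den := fun n hn => by
    rw [den_one_sub, den_sum_one_div_two_pow h0 hk]
    have : 0 < k (J n) := h0.trans_le (hk.monotone (Nat.zero_le _))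
    exact Nat.le_self_pow this.ne' 2
  refine ⟨r, N, hN0, hN, fun j n h1 h2 => ?_, fun j => ?_⟩
  · have hn : 1 ≤ n := by omega
    have : J n = j := le_antisymm (block_le_block hN le_rfl (hJ1 n hn) h2)
      (block_le_block hN le_rfl h1 (hJ2 n hn))
    simp only [r, this]
  · rw [← hNs]
    exact (lt_denTower hden2 _).le

end Blocks

/-! ### Existence of the construction and conclusion. -/

theorem exists_isBinaryExpansion {x : ℝ} (hx : Irrational x) (h0 : 0 < x) (h1 : x < 1) :
    ∃ k, IsBinaryExpansion x k := by
  have hsum := Real.hasSum_ofDigitsTerm_digits x one_lt_two ⟨h0.le, h1⟩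
  set d := Real.digits x 2 with hd
  have hterm : ∀ i, d i ≠ 1 → Real.ofDigitsTerm d i = 0 := fun i hi => by
    have : d i = 0 := by omega
    simp [Real.ofDigitsTerm, this]
  have hterm1 : ∀ i, d i = 1 → Real.ofDigitsTerm d i = 1 / 2 ^ (i + 1) := fun i hi => by
    simp [Real.ofDigitsTerm, hi]
  -- Finitely many digits `1` would make `x` rational.
  have hinf : {i | d i = 1}.Infinite := by
    intro hfin
    have h2 : x = ∑ i ∈ hfin.toFinset, Real.ofDigitsTerm d i :=
      hsum.unique (hasSum_sum_of_ne_finset_zero fun i hi => hterm i (by simpa using hi))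
    refine hx ⟨∑ i ∈ hfin.toFinset, 1 / 2 ^ (i + 1), ?_⟩
    rw [h2]
    push_cast
    exact Finset.sum_congr rfl fun i hi => (hterm1 i (by simpa using hi)).symm
  have hinf' : (Set.ofPred fun i => d i = 1).Infinite := hinf
  have hmono := Nat.nth_strictMono hinf'
  -- The shift by one is there because digit `i`, counted from `0`, has weight `2 ^ (-(i + 1))`.
  refine ⟨fun i => Nat.nth (fun i => d i = 1) i + 1, by simp, fun i j hij => ?_, ?_⟩
  · simpa using hmono hij
  · have h3 := (hmono.injective.hasSum_iff (f := Real.ofDigitsTerm d) (a := x) ?_).2 hsum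
    · refine h3.congr_fun fun i => ?_
      exact (hterm1 _ (Nat.nth_mem_of_infinite hinf' i)).symm
    · intro i hi
      refine hterm i fun h => hi ?_
      rw [Nat.range_nth_of_infinite hinf']
      exact h

theorem exists_isConstructedSequence {β : ℝ} (hβ : 1 < β) :
    ∃ r : ℕ → ℚ, IsConstructedSequence β r := by
  by_cases hirr : Irrational β
  · have hx : Irrational (1 - 1 / β) := by
      rw [one_div]
      exact_mod_cast hirr.inv.ratCast_sub 1
    have hβ' : 1 / β < 1 := by rw [div_lt_one (by linarith)]; exact hβ
    have hβ'' : 0 < 1 / β := by positivity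
    obtain ⟨k, hk⟩ := exists_isBinaryExpansion hx (by linarith) (by linarith)
    obtain ⟨r, N, hN0, hN, hr, hlong⟩ := exists_blocks hk.1 hk.2.1
    exact ⟨r, .irrational hirr k N hk hN0 hN hr hlong⟩
  · obtain ⟨x, rfl⟩ : ∃ x : ℚ, (x : ℝ) = β := by simpa [Irrational] using hirr
    have hx1 : 1 < x := by exact_mod_cast hβ
    have hnum : ((x.num.toNat : ℕ) : ℤ) = x.num :=
      Int.toNat_of_nonneg (Rat.num_nonneg.2 (by linarith))
    have hxdiv : x = (x.num.toNat : ℚ) / x.den := by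
      conv_lhs => rw [← Rat.num_div_den x, ← hnum, Int.cast_natCast]
    have hden : (0 : ℚ) < x.den := by exact_mod_cast x.den_pos
    refine ⟨fun _ => (x.den : ℚ) / x.num.toNat,
      .rational x.den x.num.toNat x.den_pos ?_ ?_ ?_ fun _ _ => rfl⟩
    · rw [hxdiv, one_lt_div hden] at hx1
      exact_mod_cast hx1
    · have := x.reduced.symm
      have e : x.num.natAbs = x.num.toNat := by omega
      rwa [e] at this
    · simpa only [Rat.cast_div, Rat.cast_natCast] using congrArg (Rat.cast : ℚ → ℝ) hxdiv

theorem IsConstructedSequence.isAdmissible {β : ℝ} {r : ℕ → ℚ}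
    (h : IsConstructedSequence β r) : IsAdmissible β r := by
  cases h with
  | rational a b ha hab hcop hβ hr => exact .of_const ha hab hcop hβ hr
  | irrational _ k N hk hN0 hN hr hlong => exact .of_blocks hk hN0 hN hr hlong

theorem IsConstructedSequence.seriesTerm_eq {β : ℝ} {r : ℕ → ℚ}
    (h : IsConstructedSequence β r) (hβ : 1 < β) {a b : ℕ} (hb : 0 < b)
    (hcop : Nat.Coprime b a) (hab : β = (b : ℝ) / a) (n : ℕ) :
    seriesTerm r n = β ^ (-(tower (fun _ => b) n : ℝ)) := by
  have hβ0 : 0 < β := by linarith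
  have ha : 0 < a := by
    rcases Nat.eq_zero_or_pos a with rfl | ha
    · simp at hab; linarith
    · exact ha
  cases h with
  | irrational hirr => exact absurd ⟨(b : ℚ) / a, by rw [hab]; push_cast; rfl⟩ hirr
  | rational a' b' ha' hab' hcop' hβ' hr =>
    have hq : (b' : ℚ) / a' = (b : ℚ) / a := by
      apply Rat.cast_injective (α := ℝ)
      simpa only [Rat.cast_div, Rat.cast_natCast] using hβ'.symm.trans hab
    have hr' : ∀ n, 1 ≤ n → r n = (a : ℚ) / b := fun n hn => by
      rw [hr n hn, ← inv_div, hq, inv_div]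
    have hT : ∀ n, denTower r n = tower (fun _ => b) n := by
      intro n
      induction n with
      | zero => rfl
      | succ n ih =>
        rw [denTower_succ, ih, hr' (n + 1) (by omega),
          den_natCast_div_of_coprime hb hcop.symm]
        rfl
    rw [seriesTerm, hT, hr' (n + 1) (by omega), Real.rpow_neg hβ0.le, Real.rpow_natCast, ← inv_pow,
      hab, inv_div]
    push_cast
    rfl

theorem theorem4 (β : ℝ) (hβ : 1 < β) :
    (∃ r : ℕ → ℚ, IsConstructedSequence β r) ∧
    ∀ r : ℕ → ℚ, IsConstructedSequence β r →
      ∃ τ : ℝ, HasSum (seriesTerm r) τ ∧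
        HasIrrationalityBase τ β ∧
        (∃ Q : ℕ, 0 < Q ∧
          ∀ (p : ℤ) (q : ℕ), Q ≤ q → 1 / β ^ q < |τ - (p : ℝ) / (q : ℝ)|) ∧
        ¬ ApproximableToOrder τ (fun x => β ^ (-x)) ∧
        ∀ a b : ℕ, 0 < b → Nat.Coprime b a → β = (b : ℝ) / (a : ℝ) →
          HasSum (fun n : ℕ => β ^ (-(tower (fun _ => b) n : ℝ))) τ := by
  refine ⟨exists_isConstructedSequence hβ, fun r hr => ?_⟩
  have h := hr.isAdmissible
  have hτ := (h.summable hβ).hasSum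
  refine ⟨_, hτ, h.hasIrrationalityBase hβ hτ, h.exists_forall_lt_abs_sub hβ hτ,
    h.not_approximableToOrder hβ hτ, fun a b hb hcop hab => ?_⟩
  exact (funext (hr.seriesTerm_eq hβ hb hcop hab)) ▸ hτ
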